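/- Let $n,m,q\ge 0$ be integers. A set $C\subseteq\mathbb R^l$ is \emph{semialgebraic} if it is a finite union $C=\bigcup_{j} K_j$ of sets each of the form $K_j=\{f_{1,j}=0,\dots,f_{r_j,j}=0,\ g_{1,j}>0,\dots,g_{s_j,j}>0\}$ with finitely many real polynomials $f_{i,j},g_{h,j}$ in $l$ variables. For a map $f=(f_1,\dots,f_m):\mathbb R^n\to\mathbb R^m$, a point $x$ \emph{dominates} a point $y$ if $f_i(x)\ge f_i(y)$ for all $i$ and $f_j(x)>f_j(y)$ for at least one $j$; a point $p$ is a \emph{local Pareto optimum} of $f$ if it has a neighborhood containing no point that dominates $p$. Identify the vector space of polynomial maps $\mathbb R^n\to\mathbb R^m$ of degree at most $q$ that vanish at $0$ with $\mathbb R^l=\{(a_\iota)_{0<|\iota|\le q} : a_\iota\in\mathbb R^m\}$, where $\iota$ runs over multi-indices in $\mathbb N^n$, by letting $a=(a_\iota)$ correspond to $f(a,x)=\sum_{0<|\iota|\le q}a_\iota x^\iota$. Then the set $$E=\{a\in\mathbb R^l : f(a,\cdot)\text{ has a local Pareto optimum at }0\}$$ is a semialgebraic subset of $\mathbb R^l$.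 -/

import Mathlib

namespace ParetoSemialg

/-- A subset of the real coordinate space `ℝ^σ` is semialgebraic if it is a finite union of sets,
each of which is defined by finitely many polynomial equations `p = 0` and finitely many strict
polynomial inequalities `g > 0`. -/
def IsSemialgebraic {σ : Type*} (C : Set (σ → ℝ)) : Prop :=
  ∃ (N : ℕ) (F G : Fin N → Finset (MvPolynomial σ ℝ)),
    C = ⋃ j : Fin N, {x | (∀ p ∈ F j, MvPolynomial.eval x p = 0) ∧
      (∀ g ∈ G j, 0 < MvPolynomial.eval x g)}

/-- `x` dominates `y` for the objective functions `f₁, …, fₘ` (the components of `f`):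
`fᵢ x ≥ fᵢ y` for all `i`, with strict inequality for at least one index. -/
def Dominates {X : Type*} {m : ℕ} (f : X → Fin m → ℝ) (x y : X) : Prop :=
  (∀ i, f x i ≥ f y i) ∧ ∃ j, f x j > f y j

/-- `x ∈ U` is a Pareto optimum of `f` restricted to `U` if no point of `U` dominates `x`. -/
def IsParetoOptimumOn {X : Type*} {m : ℕ} (f : X → Fin m → ℝ) (U : Set X) (x : X) : Prop :=
  x ∈ U ∧ ¬ ∃ y ∈ U, Dominates f y x

/-- `p` is a local Pareto optimum of `f` if it is Pareto optimal on some neighbourhood of `p`. -/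
def IsLocalParetoOptimum {X : Type*} [TopologicalSpace X] {m : ℕ} (f : X → Fin m → ℝ)
    (p : X) : Prop :=
  ∃ U ∈ nhds p, IsParetoOptimumOn f U p

/-- The finite set of multi-indices `ι ∈ ℕ^n` with `0 < |ι| ≤ q`. -/
def multiIndices (n q : ℕ) : Finset (Fin n → ℕ) :=
  (Fintype.piFinset fun _ => Finset.range (q + 1)).filter
    fun ι => 0 < ∑ i, ι i ∧ ∑ i, ι i ≤ q

theorem mem_multiIndices {n q : ℕ} {ι : Fin n → ℕ} :
    ι ∈ multiIndices n q ↔ 0 < ∑ i, ι i ∧ ∑ i, ι i ≤ q := by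
  simp only [multiIndices, Finset.mem_filter, Fintype.mem_piFinset, Finset.mem_range,
    and_iff_right_iff_imp]
  intro h i
  have := Finset.single_le_sum (f := ι) (fun _ _ => Nat.zero_le _) (Finset.mem_univ i)
  omega

/-- The coordinates of the coefficient space `ℝ^l`: one for every multi-index `ι` with
`0 < |ι| ≤ q` and every component `j` of a map to `ℝ^m`. -/
abbrev CoeffIndex (n m q : ℕ) : Type := multiIndices n q × Fin m

/-- The polynomial map `f(a, ·) : ℝ^n → ℝ^m`, `f(a, x) = ∑_ι a_ι x^ι`, of degree at most `q` and
vanishing at `0`, with coefficient vector `a`. -/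
def polyMap {n m q : ℕ} (a : CoeffIndex n m q → ℝ) (x : Fin n → ℝ) : Fin m → ℝ :=
  fun j => ∑ ι : multiIndices n q, a (ι, j) * ∏ i, x i ^ ι.1 i

end ParetoSemialg

/-!
A set whose membership depends only on the signs of finitely many polynomials is semialgebraic, and
such sets are closed under Boolean operations. That `0` is a local Pareto optimum of `f(a, ·)` says
that for some `ε > 0` no `x` in the `ε`-cube around `0` dominates `0`, so what is needed is closure
under projection along one variable.

Regard the given polynomials as univariate polynomials whose coefficients are functions of the
parameters. As soon as finitely many polynomial functions take equal signs at two parameters, some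
order isomorphism of `ℝ` carries the sign patterns of all members of the family at the first
parameter to those at the second, and hence carries a witness over the first to one over the
second. The isomorphism is built by induction on the degree. Suppose that it already matches `p'`,
other members of at most the degree of `p`, and the pseudo-remainders of `p` by all of these.
Between consecutive roots of `p'` the polynomial `p` is injective, and at the roots of `p'` its
signs are those of a pseudo-remainder, so by the intermediate value theorem the roots of `p` at the
two parameters lie in corresponding gaps. The isomorphism can then be moved to match these roots as
well, while it stays fixed at the roots of the other members, whose signs are therefore still
matched.
-/

namespace ParetoSemialg

open Asymptotics Filter Polynomial Set

section OrderIso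

variable {K : Type*} [Field K] [LinearOrder K] [IsStrictOrderedRing K]

theorem exists_orderIso_eq_self_and_map_eq {c x y : K} (hx : c < x) (hy : c < y) :
    ∃ φ : K ≃o K, (∀ z ≤ c, φ z = z) ∧ φ x = y := by
  have hslope : 0 < (y - c) / (x - c) := div_pos (sub_pos.2 hy) (sub_pos.2 hx)
  set k := (y - c) / (x - c)
  let stretch : K → K := fun z => if z ≤ c then z else c + k * (z - c)
  have stretch_mono : StrictMono stretch := by
    intro z w hzw
    by_cases hz : z ≤ c <;> by_cases hw : w ≤ c
    · simpa only [stretch, if_pos hz, if_pos hw]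
    · simp only [stretch, if_pos hz, if_neg hw]
      nlinarith [mul_pos hslope (sub_pos.2 (not_le.1 hw))]
    · exact absurd (hzw.le.trans hw) hz
    · simp only [stretch, if_neg hz, if_neg hw]
      gcongr
  have stretch_surj : Function.Surjective stretch := by
    intro w
    by_cases hw : w ≤ c
    · exact ⟨w, if_pos hw⟩
    · have hpre : c < c + (w - c) / k :=
        lt_add_of_pos_right c (div_pos (sub_pos.2 (not_le.1 hw)) hslope)
      refine ⟨c + (w - c) / k, ?_⟩
      simp only [stretch, if_neg hpre.not_ge]
      field_simp
      ring
  refine ⟨stretch_mono.orderIsoOfSurjective stretch stretch_surj, fun z hz => if_pos hz, ?_⟩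
  have hxc : x - c ≠ 0 := (sub_pos.2 hx).ne'
  simp [stretch, hx.not_ge, k, hxc]

theorem exists_orderIso_eqOn_of_strictMonoOn (s : Finset K) {f : K → K} (hf : StrictMonoOn f s) :
    ∃ φ : K ≃o K, EqOn φ f s := by
  induction s using Finset.induction_on_max with
  | empty => exact ⟨OrderIso.refl K, by simp⟩
  | insert x s hlt ih =>
    obtain ⟨φ, hφ⟩ := ih (hf.mono (by simp))
    rcases s.eq_empty_or_nonempty with rfl | hs
    · exact ⟨OrderIso.addRight (f x - x), by simp⟩
    have hmax := s.max'_mem hs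
    obtain ⟨ψ, hψ, hψx⟩ := exists_orderIso_eq_self_and_map_eq
      (φ.lt_iff_lt.2 (hlt _ hmax)) (y := f x)
      (hφ hmax ▸ hf (by simp [hmax]) (by simp) (hlt _ hmax))
    refine ⟨φ.trans ψ, fun z hz => ?_⟩
    rcases Finset.mem_insert.1 (Finset.mem_coe.1 hz) with rfl | hz
    · exact hψx
    · exact (hψ _ (φ.monotone (s.le_max' z hz))).trans (hφ hz)

end OrderIso

section Sign

theorem eq_zero_iff_of_sign_eq {α : Type*} [Zero α] [LinearOrder α] {u v : α}
    (h : SignType.sign u = SignType.sign v) : u = 0 ↔ v = 0 := by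
  rw [← sign_eq_zero_iff, h, sign_eq_zero_iff]

theorem sign_eq_sign_iff {α : Type*} [Zero α] [LinearOrder α] {u v : α} :
    SignType.sign u = SignType.sign v ↔
      (u = 0 → v = 0) ∧ (0 < u → 0 < v) ∧ (u < 0 → v < 0) := by
  rcases lt_trichotomy u 0 with hu | rfl | hu
  · simp [hu, hu.ne, hu.not_gt, sign_neg, eq_comm (b := SignType.sign v), sign_eq_neg_one_iff]
  · simp [eq_comm (b := SignType.sign v), sign_eq_zero_iff]
  · simp [hu, hu.ne', hu.not_gt, sign_pos, eq_comm (b := SignType.sign v), sign_eq_one_iff]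

variable {R : Type*} [Ring R] [LinearOrder R] [IsStrictOrderedRing R]

theorem mul_nonneg_of_sign_eq {u v : R} (h : SignType.sign u = SignType.sign v) : 0 ≤ u * v := by
  rw [← sign_nonneg_iff, sign_mul, h]
  cases SignType.sign v <;> decide

theorem mul_neg_of_sign_ne {u v : R} (h : SignType.sign u ≠ SignType.sign v) (hu : u ≠ 0)
    (hv : v ≠ 0) : u * v < 0 := by
  rcases hu.lt_or_gt with hu | hu <;> rcases hv.lt_or_gt with hv | hv
  · exact absurd (by rw [sign_neg hu, sign_neg hv]) h
  · exact mul_neg_of_neg_of_pos hu hv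
  · exact mul_neg_of_pos_of_neg hu hv
  · exact absurd (by rw [sign_pos hu, sign_pos hv]) h

end Sign

section Gaps

variable {α β : Type*} [LinearOrder α]

/-- `x` and `y` compare in the same way with every point of `Z`: they are the same point of `Z`,
or lie in the same gap between points of `Z`. -/
def SameGap (Z : Finset α) (x y : α) : Prop :=
  ∀ z ∈ Z, cmp z x = cmp z y

theorem SameGap.eq_of_mem {Z : Finset α} {x y : α} (h : SameGap Z x y) (hx : x ∈ Z) : y = x :=
  ((cmp_eq_eq_iff x y).1 ((h x hx).symm.trans (cmp_self_eq_eq x))).symm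

theorem strictMonoOn_of_sameGap {Z : Finset α} {move : α → α} (hmove : ∀ x, SameGap Z x (move x))
    {s : Set α} (hs : ∀ x ∈ s, ∀ y ∈ s, x < y → ∃ z ∈ Z, z ∈ Icc x y) : StrictMonoOn move s := by
  intro x hx y hy hxy
  obtain ⟨z, hz, hxz, hzy⟩ := hs x hx y hy hxy
  have := hmove x z hz
  have := hmove y z hz
  grind [cmp_eq_lt_iff, cmp_eq_eq_iff, cmp_eq_gt_iff]

theorem exists_gt_forall_notMem_Ioo [NoMaxOrder α] [Nonempty α] {Z : Finset α} {p : α → Prop}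
    (hZ : ∀ z ∈ Z, p z) (hp : ∀ᶠ x in atTop, p x) (x : α) :
    ∃ u > x, p u ∧ ∀ z ∈ Z, z ∉ Ioo x u := by
  by_cases hne : (Z.filter (x < ·)).Nonempty
  · obtain ⟨hmem, hlt⟩ := Finset.mem_filter.1 (Finset.min'_mem _ hne)
    exact ⟨_, hlt, hZ _ hmem, fun z hz hzI =>
      (Finset.min'_le _ z (Finset.mem_filter.2 ⟨hz, hzI.1⟩)).not_gt hzI.2⟩
  · obtain ⟨u, hu, hxu⟩ := (hp.and (eventually_gt_atTop x)).exists
    exact ⟨u, hxu, hu, fun z hz hzI => hne ⟨z, Finset.mem_filter.2 ⟨hz, hzI.1⟩⟩⟩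

theorem exists_lt_forall_notMem_Ioo [NoMinOrder α] [Nonempty α] {Z : Finset α} {p : α → Prop}
    (hZ : ∀ z ∈ Z, p z) (hp : ∀ᶠ x in atBot, p x) (x : α) :
    ∃ s < x, p s ∧ ∀ z ∈ Z, z ∉ Ioo s x := by
  obtain ⟨s, hs, hps, hgap⟩ := exists_gt_forall_notMem_Ioo (α := αᵒᵈ) hZ hp x
  exact ⟨s, hs, hps, fun z hz hzI => hgap z hz hzI.symm⟩

/-- Between any two points at which `f` takes the same value there is a point of `Z`. This is the
conclusion of Rolle's theorem when `Z` contains the critical points of `f`. -/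
def SeparatesFibers (Z : Finset α) (f : α → β) : Prop :=
  ∀ ⦃x y⦄, x < y → f x = f y → ∃ z ∈ Z, z ∈ Ioo x y

variable {Z : Finset α} {f : α → β}

theorem SeparatesFibers.injOn_Icc (hf : SeparatesFibers Z f) {s u : α}
    (hsu : ∀ z ∈ Z, z ∉ Ioo s u) : InjOn f (Icc s u) := by
  have hne : ∀ x ∈ Icc s u, ∀ y ∈ Icc s u, x < y → f x ≠ f y := by
    intro x hx y hy hxy heq
    obtain ⟨z, hz, hzI⟩ := hf hxy heq
    exact hsu z hz ⟨hx.1.trans_lt hzI.1, hzI.2.trans_le hy.2⟩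
  intro x hx y hy heq
  by_contra hxy
  rcases lt_or_gt_of_ne hxy with hlt | hlt
  · exact hne x hx y hy hlt heq
  · exact hne y hy x hx hlt heq.symm

theorem SeparatesFibers.eq_of_sameGap (hf : SeparatesFibers Z f) {x y : α} (hxy : SameGap Z x y)
    (heq : f x = f y) : x = y := by
  rcases lt_trichotomy x y with hlt | rfl | hlt
  · obtain ⟨z, hz, hxz, hzy⟩ := hf hlt heq
    exact absurd ((lt_iff_lt_of_cmp_eq_cmp (hxy z hz)).2 hzy) hxz.not_gt
  · rfl
  · obtain ⟨z, hz, hyz, hzx⟩ := hf hlt heq.symm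
    exact absurd ((lt_iff_lt_of_cmp_eq_cmp (hxy z hz)).1 hzx) hyz.not_gt

theorem SeparatesFibers.finite_fiber (hf : SeparatesFibers Z f) (c : β) :
    {x | f x = c}.Finite := by
  let below : α → Finset α := fun x => Z.filter (· < x)
  have hmono : StrictMonoOn below {x | f x = c} := by
    intro x hx y hy hxy
    obtain ⟨z, hz, hxz, hzy⟩ := hf hxy (Eq.trans hx hy.symm)
    refine Finset.ssubset_iff_of_subset (fun w hw => ?_) |>.2 ⟨z, ?_, ?_⟩
    · simp only [below, Finset.mem_filter] at hw ⊢
      exact ⟨hw.1, hw.2.trans hxy⟩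
    · simp [below, hz, hzy]
    · simp [below, hxz.le]
  refine Finite.of_finite_image (Z.powerset.finite_toSet.subset ?_) hmono.injOn
  rintro _ ⟨x, -, rfl⟩
  exact Finset.mem_coe.2 (Finset.mem_powerset.2 (Finset.filter_subset _ _))

end Gaps

section SameProfile

/-- Two continuous functions whose fibers are separated by `Z`, and whose signs agree on `Z` and
near `±∞`. -/
structure SameProfile (Z : Finset ℝ) (f g : ℝ → ℝ) : Prop where
  continuous_left : Continuous f
  continuous_right : Continuous g
  separates_left : SeparatesFibers Z f
  separates_right : SeparatesFibers Z g
  sign_eq : ∀ z ∈ Z, SignType.sign (f z) = SignType.sign (g z)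
  sign_atTop : ∀ᶠ x in atTop ×ˢ atTop, SignType.sign (f x.1) = SignType.sign (g x.2)
  sign_atBot : ∀ᶠ x in atBot ×ˢ atBot, SignType.sign (f x.1) = SignType.sign (g x.2)

variable {Z : Finset ℝ} {f g : ℝ → ℝ}

theorem SameProfile.symm (h : SameProfile Z f g) : SameProfile Z g f where
  continuous_left := h.continuous_right
  continuous_right := h.continuous_left
  separates_left := h.separates_right
  separates_right := h.separates_left
  sign_eq z hz := (h.sign_eq z hz).symm
  sign_atTop := (eventually_swap_iff.1 h.sign_atTop).mono fun _ => Eq.symm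
  sign_atBot := (eventually_swap_iff.1 h.sign_atBot).mono fun _ => Eq.symm

theorem exists_zero_mem_Ioo_of_mul_neg (hg : Continuous g) {s u : ℝ} (hsu : s < u)
    (hneg : g s * g u < 0) : ∃ y ∈ Ioo s u, g y = 0 := by
  rcases mul_neg_iff.1 hneg with ⟨hs, hu⟩ | ⟨hs, hu⟩
  · exact intermediate_value_Ioo' hsu.le hg.continuousOn ⟨hu, hs⟩
  · exact intermediate_value_Ioo hsu.le hg.continuousOn ⟨hs, hu⟩

theorem mul_neg_of_injOn_Icc (hf : Continuous f) {s x u : ℝ} (hsx : s < x) (hxu : x < u)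
    (hinj : InjOn f (Icc s u)) (hx : f x = 0) : f s * f u < 0 := by
  have hs : s ∈ Icc s u := ⟨le_rfl, (hsx.trans hxu).le⟩
  have hu : u ∈ Icc s u := ⟨(hsx.trans hxu).le, le_rfl⟩
  have hx' : x ∈ Icc s u := ⟨hsx.le, hxu.le⟩
  rcases hf.continuousOn.strictMonoOn_of_injOn_Icc' (hsx.trans hxu).le hinj with hmono | hanti
  · exact mul_neg_of_neg_of_pos (hx ▸ hmono hs hx' hsx) (hx ▸ hmono hx' hu hxu)
  · exact mul_neg_of_pos_of_neg (hx ▸ hanti hs hx' hsx) (hx ▸ hanti hx' hu hxu)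

theorem SameProfile.exists_zero (h : SameProfile Z f g) {x : ℝ} (hx : f x = 0) :
    ∃ y, SameGap Z x y ∧ g y = 0 := by
  by_cases hxZ : x ∈ Z
  · exact ⟨x, fun _ _ => rfl, (eq_zero_iff_of_sign_eq (h.sign_eq x hxZ)).1 hx⟩
  obtain ⟨s, hsx, hs, hsZ⟩ := exists_lt_forall_notMem_Ioo h.sign_eq h.sign_atBot.diag_of_prod x
  obtain ⟨u, hxu, hu, huZ⟩ := exists_gt_forall_notMem_Ioo h.sign_eq h.sign_atTop.diag_of_prod x
  have houtside : ∀ z ∈ Z, z ≤ s ∨ u ≤ z := by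
    intro z hz
    have hzx : z ≠ x := ne_of_mem_of_not_mem hz hxZ
    have := hsZ z hz
    have := huZ z hz
    grind
  have hinj : InjOn f (Icc s u) := h.separates_left.injOn_Icc fun z hz hzI =>
    (houtside z hz).elim hzI.1.not_ge hzI.2.not_ge
  have hneg : g s * g u < 0 := by
    have := mul_neg_of_injOn_Icc h.continuous_left hsx hxu hinj hx
    rwa [← sign_eq_neg_one_iff, sign_mul, ← hs, ← hu, ← sign_mul, sign_eq_neg_one_iff]
  obtain ⟨y, ⟨hsy, hyu⟩, hy⟩ :=
    exists_zero_mem_Ioo_of_mul_neg h.continuous_right (hsx.trans hxu) hneg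
  refine ⟨y, fun z hz => ?_, hy⟩
  rcases houtside z hz with hzs | huz
  · rw [(cmp_eq_lt_iff z x).2 (hzs.trans_lt hsx), (cmp_eq_lt_iff z y).2 (hzs.trans_lt hsy)]
  · rw [(cmp_eq_gt_iff z x).2 (hxu.trans_le huz), (cmp_eq_gt_iff z y).2 (hyu.trans_le huz)]

theorem SameProfile.exists_orderIso_zero_iff (h : SameProfile Z f g) :
    ∃ ψ : ℝ ≃o ℝ, (∀ z ∈ Z, ψ z = z) ∧ ∀ x, f x = 0 ↔ g (ψ x) = 0 := by
  classical
  have hzero : ∀ x, ∃ y, SameGap Z x y ∧ (f x = 0 → g y = 0) := by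
    intro x
    by_cases hx : f x = 0
    · exact (h.exists_zero hx).imp fun y hy => ⟨hy.1, fun _ => hy.2⟩
    · exact ⟨x, fun _ _ => rfl, fun hx' => absurd hx' hx⟩
  choose move hgap hmove using hzero
  have hfix : ∀ z ∈ Z, move z = z := fun z hz => (hgap z).eq_of_mem hz
  let zeros := (h.separates_left.finite_fiber 0).toFinset
  have hzeros {x : ℝ} : x ∈ zeros ↔ f x = 0 := by simp [zeros]
  have hsep : ∀ x ∈ Z ∪ zeros, ∀ y ∈ Z ∪ zeros, x < y → ∃ z ∈ Z, z ∈ Icc x y := by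
    intro x hx y hy hxy
    rcases Finset.mem_union.1 hx with hxZ | hx0
    · exact ⟨x, hxZ, le_rfl, hxy.le⟩
    rcases Finset.mem_union.1 hy with hyZ | hy0
    · exact ⟨y, hyZ, hxy.le, le_rfl⟩
    obtain ⟨z, hz, hxzy⟩ := h.separates_left hxy ((hzeros.1 hx0).trans (hzeros.1 hy0).symm)
    exact ⟨z, hz, Ioo_subset_Icc_self hxzy⟩
  obtain ⟨ψ, hψ⟩ := exists_orderIso_eqOn_of_strictMonoOn _ (strictMonoOn_of_sameGap hgap hsep)
  have hψ0 : ∀ x, f x = 0 → ψ x = move x := fun x hx =>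
    hψ (Finset.mem_union_right _ (hzeros.2 hx))
  refine ⟨ψ, fun z hz => (hψ (Finset.mem_union_left _ hz)).trans (hfix z hz), fun x => ?_⟩
  refine ⟨fun hx => hψ0 x hx ▸ hmove x hx, fun hx => ?_⟩
  obtain ⟨w, hw, hw0⟩ := h.symm.exists_zero hx
  have hmw : ψ x = ψ w := by
    rw [hψ0 w hw0]
    exact h.separates_right.eq_of_sameGap (fun z hz => (hw z hz).trans (hgap w z hz))
      (hx.trans (hmove w hw0).symm)
  rwa [ψ.injective hmw]

/-- On an interval where `f` and `k` have opposite signs, the nearest points at which their product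
is nonnegative yield two zeros of `f` that are not separated by `Z`. -/
theorem sign_eq_of_zero_iff {k : ℝ → ℝ} (hf : Continuous f) (hk : Continuous k)
    (hsep : SeparatesFibers Z f) (hzero : ∀ x, f x = 0 ↔ k x = 0)
    (hZ : ∀ z ∈ Z, SignType.sign (f z) = SignType.sign (k z))
    (htop : ∀ᶠ x in atTop, SignType.sign (f x) = SignType.sign (k x))
    (hbot : ∀ᶠ x in atBot, SignType.sign (f x) = SignType.sign (k x)) (x : ℝ) :
    SignType.sign (f x) = SignType.sign (k x) := by
  by_contra hne
  have hx0 : f x ≠ 0 := fun hx => hne (by rw [hx, (hzero x).1 hx])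
  have hneg : f x * k x < 0 := mul_neg_of_sign_ne hne hx0 ((hzero x).not.1 hx0)
  have hxZ : x ∉ Z := fun hx => hne (hZ x hx)
  obtain ⟨s, hsx, hs, hsZ⟩ := exists_lt_forall_notMem_Ioo hZ hbot x
  obtain ⟨u, hxu, hu, huZ⟩ := exists_gt_forall_notMem_Ioo hZ htop x
  have hcont : Continuous fun y => f y * k y := hf.mul hk
  have hf0 : ∀ y, f y * k y = 0 → f y = 0 := fun y hy =>
    (mul_eq_zero.1 hy).elim id (hzero y).2
  obtain ⟨s', hs', hs0⟩ := intermediate_value_Ico' hsx.le hcont.continuousOn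
    ⟨hneg, mul_nonneg_of_sign_eq hs⟩
  obtain ⟨u', hu', hu0⟩ := intermediate_value_Ioc hxu.le hcont.continuousOn
    ⟨hneg, mul_nonneg_of_sign_eq hu⟩
  obtain ⟨z, hz, hs'z, hzu'⟩ := hsep (hs'.2.trans hu'.1) ((hf0 s' hs0).trans (hf0 u' hu0).symm)
  rcases lt_or_gt_of_ne (ne_of_mem_of_not_mem hz hxZ) with hzx | hxz
  · exact hsZ z hz ⟨hs'.1.trans_lt hs'z, hzx⟩
  · exact huZ z hz ⟨hxz, hzu'.trans_le hu'.2⟩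

theorem SameProfile.exists_orderIso (h : SameProfile Z f g) :
    ∃ ψ : ℝ ≃o ℝ, (∀ z ∈ Z, ψ z = z) ∧
      ∀ x, SignType.sign (f x) = SignType.sign (g (ψ x)) := by
  obtain ⟨ψ, hfix, hzero⟩ := h.exists_orderIso_zero_iff
  refine ⟨ψ, hfix, sign_eq_of_zero_iff h.continuous_left (h.continuous_right.comp ψ.continuous)
    h.separates_left hzero (fun z hz => ?_) ?_ ?_⟩
  · rw [hfix z hz, h.sign_eq z hz]
  · exact (tendsto_id.prodMk ψ.tendsto_atTop).eventually h.sign_atTop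
  · exact (tendsto_id.prodMk ψ.tendsto_atBot).eventually h.sign_atBot

theorem sign_comp_eq_of_forall_zero_fixed (hf : Continuous f) {ψ : ℝ ≃o ℝ}
    (hψ : ∀ z, f z = 0 → ψ z = z) (x : ℝ) :
    SignType.sign (f (ψ x)) = SignType.sign (f x) := by
  by_cases hx : f x = 0
  · rw [hψ x hx]
  by_contra hne
  have hψx : f (ψ x) ≠ 0 := fun h0 => hx (by rwa [ψ.injective (hψ _ h0)] at h0)
  have hneg := mul_neg_of_sign_ne hne hψx hx
  rcases lt_trichotomy x (ψ x) with hlt | heq | hlt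
  · obtain ⟨z, ⟨hxz, hzψ⟩, hz⟩ := exists_zero_mem_Ioo_of_mul_neg hf hlt (mul_comm (f x) _ ▸ hneg)
    exact (hψ z hz ▸ ψ.strictMono hxz).not_gt hzψ
  · exact hne (by rw [← heq])
  · obtain ⟨z, ⟨hψz, hzx⟩, hz⟩ := exists_zero_mem_Ioo_of_mul_neg hf hlt hneg
    exact (hψ z hz ▸ ψ.strictMono hzx).not_gt hψz

end SameProfile

section UnivariatePolynomials

/-- The order isomorphism `φ` carries the sign pattern of `P` on the real line to that of `Q`. -/
def SignsMatch (φ : ℝ ≃o ℝ) (P Q : ℝ[X]) : Prop :=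
  ∀ x, SignType.sign (P.eval x) = SignType.sign (Q.eval (φ x))

variable {φ : ℝ ≃o ℝ} {P Q : ℝ[X]}

theorem SignsMatch.eval_eq_zero_iff (h : SignsMatch φ P Q) (x : ℝ) :
    P.eval x = 0 ↔ Q.eval (φ x) = 0 :=
  eq_zero_iff_of_sign_eq (h x)

theorem SignsMatch.eq_zero_iff (h : SignsMatch φ P Q) : P = 0 ↔ Q = 0 := by
  have heval (R : ℝ[X]) : R = 0 ↔ ∀ x, R.eval x = 0 :=
    ⟨fun hR x => hR ▸ eval_zero, fun hR => Polynomial.funext fun x => (hR x).trans eval_zero.symm⟩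
  rw [heval, heval, φ.surjective.forall (p := fun y => Q.eval y = 0)]
  exact forall_congr' h.eval_eq_zero_iff

theorem eventually_sign_eq_of_isEquivalent {α : Type*} {l : Filter α} {u v : α → ℝ}
    (h : u ~[l] v) : ∀ᶠ x in l, SignType.sign (u x) = SignType.sign (v x) := by
  obtain ⟨r, hr, huv⟩ := h.exists_pos_eq_mul
  filter_upwards [hr, huv] with x hrx hx
  rw [hx, Pi.mul_apply, sign_mul, sign_pos hrx, one_mul]

theorem eventually_sign_eval_eq_atTop
    (hlead : SignType.sign P.leadingCoeff = SignType.sign Q.leadingCoeff) :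
    ∀ᶠ x in atTop ×ˢ atTop, SignType.sign (P.eval x.1) = SignType.sign (Q.eval x.2) := by
  have hsign (R : ℝ[X]) : ∀ᶠ x in atTop,
      SignType.sign (R.eval x) = SignType.sign R.leadingCoeff := by
    filter_upwards [eventually_sign_eq_of_isEquivalent R.isEquivalent_atTop_lead,
      eventually_gt_atTop 0] with x hx hpos
    rw [hx, sign_mul, sign_pos (pow_pos hpos _), mul_one]
  filter_upwards [(hsign P).prod_mk (hsign Q)] with x hx
  rw [hx.1, hx.2, hlead]

theorem eventually_sign_eval_eq_atBot (hdeg : P.natDegree = Q.natDegree)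
    (hlead : SignType.sign P.leadingCoeff = SignType.sign Q.leadingCoeff) :
    ∀ᶠ x in atBot ×ˢ atBot, SignType.sign (P.eval x.1) = SignType.sign (Q.eval x.2) := by
  have hsign (R : ℝ[X]) : ∀ᶠ x in atBot, SignType.sign (R.eval x) =
      SignType.sign R.leadingCoeff * (-1) ^ R.natDegree := by
    filter_upwards [eventually_sign_eq_of_isEquivalent R.isEquivalent_atBot_lead,
      eventually_lt_atBot 0] with x hx hneg
    rw [hx, sign_mul, sign_pow, sign_neg hneg]
  filter_upwards [(hsign P).prod_mk (hsign Q)] with x hx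
  rw [hx.1, hx.2, hlead, hdeg]

theorem separatesFibers_eval {Z : Finset ℝ} (hZ : ∀ z, P.derivative.eval z = 0 → z ∈ Z) :
    SeparatesFibers Z (P.eval ·) := by
  intro x y hxy heq
  obtain ⟨z, hz, hz0⟩ := exists_deriv_eq_zero hxy P.continuousOn heq
  exact ⟨z, hZ z (by rwa [← P.deriv]), hz⟩

theorem SignsMatch.exists_orderIso_of_derivative (h : SignsMatch φ P.derivative Q.derivative)
    (hdeg : P.natDegree = Q.natDegree)
    (hlead : SignType.sign P.leadingCoeff = SignType.sign Q.leadingCoeff) {Z : Finset ℝ}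
    (hZ : ∀ z, P.derivative.eval z = 0 → z ∈ Z)
    (hsign : ∀ z ∈ Z, SignType.sign (P.eval z) = SignType.sign (Q.eval (φ z))) :
    ∃ ψ : ℝ ≃o ℝ, (∀ z ∈ Z, ψ z = z) ∧ SignsMatch (ψ.trans φ) P Q :=
  SameProfile.exists_orderIso (f := (P.eval ·)) (g := fun x => Q.eval (φ x))
    { continuous_left := P.continuous
      continuous_right := Q.continuous.comp φ.continuous
      separates_left := separatesFibers_eval hZ
      separates_right := by
        intro x y hxy heq
        obtain ⟨z, hz, hz0⟩ := exists_deriv_eq_zero (φ.strictMono hxy) Q.continuousOn heq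
        rw [Q.deriv] at hz0
        refine ⟨φ.symm z, hZ _ ((h.eval_eq_zero_iff _).2 (by simpa using hz0)), ?_⟩
        exact ⟨φ.lt_symm_apply.2 hz.1, φ.symm_apply_lt.2 hz.2⟩
      sign_eq := hsign
      sign_atTop := (tendsto_id.prodMap φ.tendsto_atTop).eventually
        (eventually_sign_eval_eq_atTop hlead)
      sign_atBot := (tendsto_id.prodMap φ.tendsto_atBot).eventually
        (eventually_sign_eval_eq_atBot hdeg hlead) }

theorem SignsMatch.orderIso_trans (h : SignsMatch φ P Q) {ψ : ℝ ≃o ℝ}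
    (hψ : P ≠ 0 → ∀ z, P.eval z = 0 → ψ z = z) : SignsMatch (ψ.trans φ) P Q := by
  intro x
  rcases eq_or_ne P 0 with rfl | hP
  · simp [h.eq_zero_iff.1 rfl]
  · exact (sign_comp_eq_of_forall_zero_fixed P.continuous (hψ hP) x).symm.trans (h (ψ x))

end UnivariatePolynomials

section Elimination

variable {A : Type*} [CommRing A]

/-- The points `a` and `b` of `A` give equal signs to all members of `S`. -/
def SignEq (S : Finset A) (a b : A →+* ℝ) : Prop :=
  ∀ s ∈ S, SignType.sign (a s) = SignType.sign (b s)

theorem SignEq.mono {S S' : Finset A} (h : S ⊆ S') {a b : A →+* ℝ} (hab : SignEq S' a b) :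
    SignEq S a b :=
  fun s hs => hab s (h hs)

/-- The signs of the members of `S` at a point of `A` determine the sign patterns, on the real
line, of the specializations at that point of all members of `L`, up to one order isomorphism
common to all members. -/
def DeterminesSigns (S : Finset A) (L : Finset A[X]) : Prop :=
  ∀ a b : A →+* ℝ, SignEq S a b → ∃ φ : ℝ ≃o ℝ, ∀ p ∈ L, SignsMatch φ (p.map a) (p.map b)

theorem DeterminesSigns.mono {S : Finset A} {L M : Finset A[X]} (hM : DeterminesSigns S M)
    (h : L ⊆ M) : DeterminesSigns S L :=
  fun a b hab => (hM a b hab).imp fun _ hφ p hp => hφ p (h hp)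

section Coefficients

variable {p : A[X]} {a b : A →+* ℝ}

theorem SignEq.sign_coeff_map (h : SignEq p.coeffs a b) (i : ℕ) :
    SignType.sign ((p.map a).coeff i) = SignType.sign ((p.map b).coeff i) := by
  rw [coeff_map, coeff_map]
  by_cases hi : p.coeff i = 0
  · simp [hi]
  · exact h _ (coeff_mem_coeffs hi)

theorem SignEq.natDegree_map (h : SignEq p.coeffs a b) :
    (p.map a).natDegree = (p.map b).natDegree := by
  have hsupp : (p.map a).support = (p.map b).support := by
    ext i
    rw [mem_support_iff, mem_support_iff, Ne, eq_zero_iff_of_sign_eq (h.sign_coeff_map i)]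
  rw [natDegree, natDegree, degree, degree, hsupp]

theorem map_eraseLead_of_map_leadingCoeff_eq_zero (h : a p.leadingCoeff = 0) :
    p.eraseLead.map a = p.map a := by
  have hsplit := congr_arg (Polynomial.map a) p.eraseLead_add_C_mul_X_pow
  rwa [Polynomial.map_add, Polynomial.map_mul, map_C, h, C_0, zero_mul, add_zero] at hsplit

end Coefficients

section Reduction

/-- One step of the pseudo-division of `p` by `q`, where `q` is treated as a polynomial of degree
`e`. The truncation below the degree of `p` has no effect at points where `q` does have degree
`e`. -/
noncomputable def reduction (p q : A[X]) (e : ℕ) : A[X] :=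
  (C (q.coeff e ^ 2) * p - C (q.coeff e * p.leadingCoeff) * X ^ (p.natDegree - e) * q) %ₘ
    X ^ p.natDegree

theorem natDegree_modByMonic_X_pow_lt (p : A[X]) {d : ℕ} (hd : 0 < d) :
    (p %ₘ X ^ d).natDegree < d := by
  rcases subsingleton_or_nontrivial A with _ | _
  · rwa [Subsingleton.elim (p %ₘ X ^ d) 0, natDegree_zero]
  simpa using natDegree_modByMonic_lt p (monic_X_pow d) fun h => by
    simpa [hd.ne'] using congr_arg natDegree h

variable {p q : A[X]} {e : ℕ} {a : A →+* ℝ}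

theorem map_reduction (hq : (q.map a).natDegree = e) (he : e ≤ p.natDegree) :
    (reduction p q e).map a = C (a (q.coeff e) ^ 2) * p.map a -
      C (a (q.coeff e) * a p.leadingCoeff) * X ^ (p.natDegree - e) * q.map a := by
  rw [reduction, map_modByMonic a (monic_X_pow _), Polynomial.map_pow, map_X,
    (modByMonic_eq_self_iff (monic_X_pow _)).2]
  · simp
  rw [degree_X_pow, degree_lt_iff_coeff_zero]
  intro i hi
  simp only [Polynomial.map_sub, Polynomial.map_mul, map_C, Polynomial.map_pow, map_X, map_pow,
    map_mul, coeff_sub]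
  rw [← C_pow, ← C_mul, coeff_C_mul, mul_assoc, coeff_C_mul, coeff_X_pow_mul', if_pos (by lia)]
  rcases hi.eq_or_lt with rfl | hi
  · rw [Nat.sub_sub_self he]
    simp only [coeff_map, coeff_natDegree]
    ring
  · rw [coeff_map, coeff_eq_zero_of_natDegree_lt hi,
      coeff_eq_zero_of_natDegree_lt (p := q.map a) (by lia)]
    simp

theorem sign_eval_map_reduction (hq : (q.map a).natDegree = e) (he : e ≤ p.natDegree)
    (hq0 : q.map a ≠ 0) {x : ℝ} (hx : (q.map a).eval x = 0) :
    SignType.sign (((reduction p q e).map a).eval x) = SignType.sign ((p.map a).eval x) := by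
  have hqe : a (q.coeff e) ≠ 0 := by
    rw [← coeff_map, ← hq]
    exact leadingCoeff_ne_zero.2 hq0
  rw [map_reduction hq he]
  simp only [eval_sub, eval_mul, eval_C, hx, mul_zero, sub_zero]
  rw [sign_mul, sign_pos (by positivity), one_mul]

/-- The polynomials of degree less than that of `p` whose sign patterns, together with those of
the members of `L`, control the sign pattern of `p`. -/
noncomputable def reductions [DecidableEq A[X]] (p : A[X]) (L : Finset A[X]) : Finset A[X] :=
  insert p.eraseLead
    ((L ×ˢ Finset.range (p.natDegree + 1)).image fun c => reduction p c.1 c.2)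

theorem eraseLead_mem_reductions [DecidableEq A[X]] (p : A[X]) (L : Finset A[X]) :
    p.eraseLead ∈ reductions p L :=
  Finset.mem_insert_self _ _

theorem reduction_mem_reductions [DecidableEq A[X]] {L : Finset A[X]} (hq : q ∈ L)
    (he : e ≤ p.natDegree) :
    reduction p q e ∈ reductions p L :=
  Finset.mem_insert_of_mem <| Finset.mem_image.2
    ⟨(q, e), Finset.mem_product.2 ⟨hq, Finset.mem_range.2 (Nat.lt_succ_iff.2 he)⟩, rfl⟩

theorem natDegree_lt_of_mem_reductions [DecidableEq A[X]] {L : Finset A[X]} {r : A[X]}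
    (hp : 0 < p.natDegree) (hr : r ∈ reductions p L) : r.natDegree < p.natDegree := by
  rcases Finset.mem_insert.1 hr with rfl | hr
  · exact p.eraseLead_natDegree_le.trans_lt (by lia)
  · obtain ⟨c, -, rfl⟩ := Finset.mem_image.1 hr
    exact natDegree_modByMonic_X_pow_lt _ hp

end Reduction

section Adjunction

variable {p : A[X]} {L : Finset A[X]} {a b : A →+* ℝ} {φ : ℝ ≃o ℝ}

/-- At a root of a member of `L` the polynomial `p` has the sign of one of its reductions, which
provides the equality of signs needed to lift the matching from the derivative to `p`. -/
theorem exists_signsMatch_insert_of_leadingCoeff_ne_zero [DecidableEq A[X]]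
    (hder : derivative p ∈ L) (hdeg : ∀ q ∈ L, q.natDegree ≤ p.natDegree)
    (hp : SignEq p.coeffs a b) (hL : ∀ q ∈ L, SignEq q.coeffs a b)
    (hφ : ∀ q ∈ L ∪ reductions p L, SignsMatch φ (q.map a) (q.map b))
    (hpos : 0 < p.natDegree) (hlead : a p.leadingCoeff ≠ 0) :
    ∃ ψ : ℝ ≃o ℝ, ∀ q ∈ insert p L, SignsMatch ψ (q.map a) (q.map b) := by
  have hφL : ∀ q ∈ L, SignsMatch φ (q.map a) (q.map b) := fun q hq =>
    hφ q (Finset.mem_union_left _ hq)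
  let Z : Finset ℝ := L.biUnion fun q => (q.map a).roots.toFinset
  have hZ {z : ℝ} : z ∈ Z ↔ ∃ q ∈ L, q.map a ≠ 0 ∧ (q.map a).eval z = 0 := by simp [Z]
  have hsign : ∀ z ∈ Z,
      SignType.sign ((p.map a).eval z) = SignType.sign ((p.map b).eval (φ z)) := by
    intro z hz
    obtain ⟨q, hq, hq0, hqz⟩ := hZ.1 hz
    have he : (q.map a).natDegree ≤ p.natDegree := natDegree_map_le.trans (hdeg q hq)
    rw [← sign_eval_map_reduction rfl he hq0 hqz,
      ← sign_eval_map_reduction (hL q hq).natDegree_map.symm he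
        ((hφL q hq).eq_zero_iff.not.1 hq0) (((hφL q hq).eval_eq_zero_iff z).1 hqz)]
    exact hφ _ (Finset.mem_union_right _ (reduction_mem_reductions hq he)) z
  have hder0 : derivative (p.map a) ≠ 0 := fun h0 => by
    have := natDegree_map_of_leadingCoeff_ne_zero a hlead
    have := derivative_eq_zero.1 h0
    lia
  obtain ⟨ψ, hψZ, hψp⟩ := SignsMatch.exists_orderIso_of_derivative (P := p.map a) (Q := p.map b)
    (Z := Z) (by simpa only [derivative_map] using hφL _ hder) hp.natDegree_map
    (by simpa only [leadingCoeff, ← hp.natDegree_map] using hp.sign_coeff_map _)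
    (fun z hz => hZ.2 ⟨_, hder, by rwa [← derivative_map], by rwa [← derivative_map]⟩) hsign
  refine ⟨ψ.trans φ, Finset.forall_mem_insert _ _ _ |>.2 ⟨hψp, fun q hq => ?_⟩⟩
  exact (hφL q hq).orderIso_trans fun hq0 z hz => hψZ z (hZ.2 ⟨q, hq, hq0, hz⟩)

theorem DeterminesSigns.insert_of_reductions [DecidableEq A] [DecidableEq A[X]] {S : Finset A}
    (hder : derivative p ∈ L) (hdeg : ∀ q ∈ L, q.natDegree ≤ p.natDegree)
    (hpos : 0 < p.natDegree) (h : DeterminesSigns S (L ∪ reductions p L)) :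
    DeterminesSigns (S ∪ (insert p L).biUnion coeffs) (insert p L) := by
  intro a b hab
  obtain ⟨φ, hφ⟩ := h a b (hab.mono Finset.subset_union_left)
  have hcoeffs : ∀ q ∈ insert p L, SignEq q.coeffs a b := fun q hq => hab.mono <|
    (Finset.subset_biUnion_of_mem coeffs hq).trans Finset.subset_union_right
  have hp := hcoeffs p (Finset.mem_insert_self _ _)
  by_cases hlead : a p.leadingCoeff = 0
  · have hlead' : b p.leadingCoeff = 0 := by
      have := hp.sign_coeff_map p.natDegree
      rw [coeff_map, coeff_map] at this
      exact (eq_zero_iff_of_sign_eq this).1 hlead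
    have hmatch := hφ _ (Finset.mem_union_right _ (eraseLead_mem_reductions p L))
    rw [map_eraseLead_of_map_leadingCoeff_eq_zero hlead,
      map_eraseLead_of_map_leadingCoeff_eq_zero hlead'] at hmatch
    exact ⟨φ, (Finset.forall_mem_insert _ _ _).2
      ⟨hmatch, fun q hq => hφ q (Finset.mem_union_left _ hq)⟩⟩
  · exact exists_signsMatch_insert_of_leadingCoeff_ne_zero hder hdeg hp
      (fun q hq => hcoeffs q (Finset.mem_insert_of_mem hq)) hφ hpos hlead

end Adjunction

theorem exists_determinesSigns_of_natDegree_eq_zero {L : Finset A[X]}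
    (hL : ∀ p ∈ L, p.natDegree = 0) : ∃ S, DeterminesSigns S L := by
  classical
  refine ⟨L.biUnion coeffs, fun a b hab => ⟨OrderIso.refl ℝ, fun p hp x => ?_⟩⟩
  have hcoeff := (hab.mono (Finset.subset_biUnion_of_mem coeffs hp)).sign_coeff_map 0
  rw [eq_C_of_natDegree_eq_zero (hL p hp)] at hcoeff ⊢
  simpa using hcoeff

theorem exists_determinesSigns_union [DecidableEq A[X]] {d : ℕ}
    (hd : ∀ L : Finset A[X], (∀ p ∈ L, p.natDegree ≤ d) → ∃ S, DeterminesSigns S L)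
    {K : Finset A[X]} (hK : ∀ p ∈ K, p.natDegree = d + 1) {L : Finset A[X]}
    (hL : ∀ p ∈ L, p.natDegree ≤ d) : ∃ S, DeterminesSigns S (K ∪ L) := by
  classical
  induction K using Finset.induction_on generalizing L with
  | empty => simpa using hd L hL
  | insert p K _ ih =>
    obtain ⟨hp, hK⟩ := (Finset.forall_mem_insert _ _ _).1 hK
    have hder : (derivative p).natDegree ≤ d := (natDegree_derivative_le p).trans (by lia)
    set M := K ∪ insert (derivative p) L with hM
    have hred : ∀ r ∈ reductions p M, r.natDegree ≤ d := fun r hr =>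
      Nat.lt_succ_iff.1 ((natDegree_lt_of_mem_reductions (by lia) hr).trans_eq hp)
    obtain ⟨S, hS⟩ := ih hK (L := insert (derivative p) L ∪ reductions p M) (by grind)
    rw [← Finset.union_assoc, ← hM] at hS
    refine ⟨_, (hS.insert_of_reductions (by simp [hM]) (by grind) (by lia)).mono (by grind)⟩

theorem exists_determinesSigns (L : Finset A[X]) : ∃ S, DeterminesSigns S L := by
  classical
  suffices h : ∀ d, ∀ L : Finset A[X], (∀ p ∈ L, p.natDegree ≤ d) → ∃ S, DeterminesSigns S L from
    h _ L fun p hp => Finset.le_sup (f := natDegree) hp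
  intro d
  induction d with
  | zero =>
    exact fun L hL => exists_determinesSigns_of_natDegree_eq_zero fun p hp =>
      Nat.le_zero.1 (hL p hp)
  | succ d ih =>
    intro L hL
    rw [← Finset.filter_union_filter_not_eq (·.natDegree = d + 1) L]
    exact exists_determinesSigns_union ih (by simp) (by grind)

end Elimination

section SignDetermined

variable {σ τ : Type*}

/-- Membership in `C` depends only on the signs of finitely many polynomials. -/
def SignDetermined (C : Set (σ → ℝ)) : Prop :=
  ∃ S : Finset (MvPolynomial σ ℝ), ∀ a b : σ → ℝ,
    SignEq S (MvPolynomial.eval a) (MvPolynomial.eval b) → a ∈ C → b ∈ C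

theorem signDetermined_lt (p q : MvPolynomial σ ℝ) :
    SignDetermined {a | MvPolynomial.eval a p < MvPolynomial.eval a q} := by
  refine ⟨{q - p}, fun a b hab ha => ?_⟩
  have hsign := hab (q - p) (Finset.mem_singleton_self _)
  rw [mem_ofPred_eq, ← sub_pos, ← map_sub] at ha ⊢
  rwa [sign_pos ha, eq_comm, sign_eq_one_iff] at hsign

namespace SignDetermined

theorem compl {C : Set (σ → ℝ)} (hC : SignDetermined C) : SignDetermined Cᶜ := by
  obtain ⟨S, hS⟩ := hC
  exact ⟨S, fun a b hab ha hb => ha (hS b a (fun s hs => (hab s hs).symm) hb)⟩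

theorem iInter {ι : Type*} [Finite ι] {C : ι → Set (σ → ℝ)} (hC : ∀ i, SignDetermined (C i)) :
    SignDetermined (⋂ i, C i) := by
  classical
  have := Fintype.ofFinite ι
  choose S hS using hC
  refine ⟨Finset.univ.biUnion S, fun a b hab ha => mem_iInter.2 fun i => ?_⟩
  exact hS i a b (hab.mono (Finset.subset_biUnion_of_mem S (Finset.mem_univ i))) (mem_iInter.1 ha i)

theorem inter {C D : Set (σ → ℝ)} (hC : SignDetermined C) (hD : SignDetermined D) :
    SignDetermined (C ∩ D) := by
  rw [inter_eq_iInter]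
  exact iInter (Bool.forall_bool.2 ⟨hD, hC⟩)

theorem iUnion {ι : Type*} [Finite ι] {C : ι → Set (σ → ℝ)} (hC : ∀ i, SignDetermined (C i)) :
    SignDetermined (⋃ i, C i) := by
  rw [← compl_compl (⋃ i, C i), compl_iUnion]
  exact (iInter fun i => (hC i).compl).compl

theorem preimage_comp {C : Set (τ → ℝ)} (hC : SignDetermined C) (g : τ → σ) :
    SignDetermined ((· ∘ g) ⁻¹' C : Set (σ → ℝ)) := by
  classical
  obtain ⟨S, hS⟩ := hC
  refine ⟨S.image (MvPolynomial.rename g), fun a b hab ha => hS _ _ (fun s hs => ?_) ha⟩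
  simpa only [MvPolynomial.eval_rename] using hab _ (Finset.mem_image_of_mem _ hs)

theorem exists_option {C : Set (Option σ → ℝ)} (hC : SignDetermined C) :
    SignDetermined {a : σ → ℝ | ∃ t, (fun o => o.elim t a) ∈ C} := by
  classical
  obtain ⟨S, hS⟩ := hC
  obtain ⟨S', hS'⟩ := exists_determinesSigns (S.image (MvPolynomial.optionEquivLeft ℝ σ))
  refine ⟨S', fun a b hab => ?_⟩
  rintro ⟨t, ht⟩
  obtain ⟨φ, hφ⟩ := hS' _ _ hab
  refine ⟨φ t, hS _ _ (fun s hs => ?_) ht⟩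
  simpa only [MvPolynomial.optionEquivLeft_elim_eval] using
    hφ _ (Finset.mem_image_of_mem _ hs) t

theorem exists_sum [Finite τ] {C : Set (σ ⊕ τ → ℝ)} (hC : SignDetermined C) :
    SignDetermined {a : σ → ℝ | ∃ x, Sum.elim a x ∈ C} := by
  induction τ using Finite.induction_empty_option with
  | of_equiv e ih =>
    convert ih (hC.preimage_comp (Sum.map id e.symm)) using 1
    ext a
    simp only [mem_ofPred_eq, mem_preimage, Sum.elim_comp_map, Function.comp_id]
    exact e.symm.injective.surjective_comp_right.exists
  | h_empty =>
    convert hC.preimage_comp (Sum.elim id PEmpty.elim) using 1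
    ext a
    rw [mem_ofPred_eq, Unique.exists_iff, mem_preimage, Sum.comp_elim, Function.comp_id]
    exact iff_of_eq (congr_arg (Sum.elim a · ∈ C) (Subsingleton.elim _ _))
  | @h_option ρ _ ih =>
    convert ih (exists_option (hC.preimage_comp
      (Sum.elim (some ∘ Sum.inl) (Option.map Sum.inr)))) using 1
    ext a
    have hcomp (y : ρ → ℝ) (t : ℝ) : (fun o => Option.elim o t (Sum.elim a y)) ∘
        Sum.elim (some ∘ Sum.inl) (Option.map Sum.inr) = Sum.elim a (fun o => o.elim t y) := by
      ext (_ | _ | _) <;> rfl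
    simp only [mem_ofPred_eq, mem_preimage, hcomp]
    constructor
    · rintro ⟨x, hx⟩
      refine ⟨x ∘ some, x none, ?_⟩
      convert hx using 2
      ext (_ | _) <;> rfl
    · exact fun ⟨y, t, hy⟩ => ⟨_, hy⟩

end SignDetermined

theorem signEq_eval_iff [DecidableEq (MvPolynomial σ ℝ)] (S : Finset (MvPolynomial σ ℝ))
    (a b : σ → ℝ) : SignEq S (MvPolynomial.eval a) (MvPolynomial.eval b) ↔
      (∀ p ∈ S.filter (MvPolynomial.eval a · = 0), MvPolynomial.eval b p = 0) ∧
      ∀ g ∈ S.filter (0 < MvPolynomial.eval a ·) ∪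
        (S.filter (MvPolynomial.eval a · < 0)).image (- ·), 0 < MvPolynomial.eval b g := by
  simp only [SignEq, sign_eq_sign_iff, Finset.mem_union, or_imp, forall_and,
    Finset.forall_mem_image, Finset.mem_filter, map_neg, neg_pos, and_imp]

theorem isSemialgebraic_iUnion {ι : Type*} [Finite ι] (F G : ι → Finset (MvPolynomial σ ℝ)) :
    IsSemialgebraic (⋃ j, {a | (∀ p ∈ F j, MvPolynomial.eval a p = 0) ∧
      ∀ g ∈ G j, 0 < MvPolynomial.eval a g}) := by
  obtain ⟨N, ⟨e⟩⟩ := Finite.exists_equiv_fin ι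
  refine ⟨N, F ∘ e.symm, G ∘ e.symm, ?_⟩
  exact (e.symm.surjective.iUnion_comp fun j => {a | (∀ p ∈ F j, MvPolynomial.eval a p = 0) ∧
    ∀ g ∈ G j, 0 < MvPolynomial.eval a g}).symm

theorem SignDetermined.isSemialgebraic {C : Set (σ → ℝ)} (hC : SignDetermined C) :
    IsSemialgebraic C := by
  classical
  obtain ⟨S, hS⟩ := hC
  let signs (a : σ → ℝ) : S → SignType := fun s => SignType.sign (MvPolynomial.eval a s.1)
  choose rep hrepC hrep using fun v : signs '' C => v.2
  have hunion : C = ⋃ v, {a | SignEq S (MvPolynomial.eval (rep v)) (MvPolynomial.eval a)} := by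
    ext a
    rw [mem_iUnion]
    constructor
    · exact fun ha => ⟨⟨signs a, a, ha, rfl⟩, fun s hs => congr_fun (hrep _) ⟨s, hs⟩⟩
    · exact fun ⟨v, hv⟩ => hS _ _ hv (hrepC v)
  rw [hunion]
  simp only [signEq_eval_iff]
  exact isSemialgebraic_iUnion _ _

end SignDetermined

section Pareto

variable {m : ℕ}

theorem isLocalParetoOptimum_iff_eventually {X : Type*} [TopologicalSpace X] {f : X → Fin m → ℝ}
    {p : X} : IsLocalParetoOptimum f p ↔ ∀ᶠ x in nhds p, ¬ Dominates f x p := by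
  constructor
  · rintro ⟨U, hU, -, h⟩
    exact mem_of_superset hU fun x hx hdom => h ⟨x, hx, hdom⟩
  · exact fun h => ⟨_, h, h.self_of_nhds, fun ⟨_, hx, hdom⟩ => hx hdom⟩

theorem isLocalParetoOptimum_pi_iff {τ : Type*} [Finite τ] {f : (τ → ℝ) → Fin m → ℝ}
    {p : τ → ℝ} : IsLocalParetoOptimum f p ↔
      ∃ ε > 0, ¬ ∃ x, (∀ i, |x i - p i| < ε) ∧ Dominates f x p := by
  have := Fintype.ofFinite τ
  rw [isLocalParetoOptimum_iff_eventually, Metric.nhds_basis_ball.eventually_iff]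
  refine exists_congr fun ε => and_congr_right fun hε => ?_
  simp only [Metric.mem_ball, dist_pi_lt_iff hε, Real.dist_eq, not_exists, not_and]

variable {σ τ : Type*}

theorem signDetermined_dominates (f : Fin m → MvPolynomial (σ ⊕ τ) ℝ) (p : τ → ℝ) :
    SignDetermined {w : σ ⊕ τ → ℝ | Dominates
      (fun x j => MvPolynomial.eval (Sum.elim (w ∘ Sum.inl) x) (f j)) (w ∘ Sum.inr) p} := by
  let f₀ (j : Fin m) : MvPolynomial (σ ⊕ τ) ℝ :=
    MvPolynomial.bind₁ (Sum.elim (MvPolynomial.X ∘ Sum.inl) (MvPolynomial.C ∘ p)) (f j)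
  have hf₀ (w : σ ⊕ τ → ℝ) (j : Fin m) : MvPolynomial.eval w (f₀ j) =
      MvPolynomial.eval (Sum.elim (w ∘ Sum.inl) p) (f j) := by
    refine (MvPolynomial.eval₂Hom_bind₁ _ _ _ _).trans
      (congr_arg (fun v => MvPolynomial.eval v (f j)) (_root_.funext ?_))
    rintro (i | i) <;> simp
  convert (SignDetermined.iInter fun j => (signDetermined_lt (f j) (f₀ j)).compl).inter
    (SignDetermined.iUnion fun j => signDetermined_lt (f₀ j) (f j)) using 1
  ext w
  simp only [Dominates, mem_ofPred_eq, Sum.elim_comp_inl_inr, ge_iff_le, gt_iff_lt, mem_inter_iff,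
    mem_iInter, mem_iUnion, mem_compl_iff, not_lt, hf₀]

theorem signDetermined_abs_sub_lt (i j : σ) (c : ℝ) :
    SignDetermined {w : σ → ℝ | |w i - c| < w j} := by
  convert (signDetermined_lt (- MvPolynomial.X j) (MvPolynomial.X i - MvPolynomial.C c)).inter
    (signDetermined_lt (MvPolynomial.X i - MvPolynomial.C c) (MvPolynomial.X j)) using 1
  ext w
  simp [abs_lt]

theorem signDetermined_isLocalParetoOptimum [Finite τ] (f : Fin m → MvPolynomial (σ ⊕ τ) ℝ)
    (p : τ → ℝ) : SignDetermined {a : σ → ℝ |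
      IsLocalParetoOptimum (fun x j => MvPolynomial.eval (Sum.elim a x) (f j)) p} := by
  have hcube : SignDetermined {w : Option σ ⊕ τ → ℝ |
      ∀ i, |w (Sum.inr i) - p i| < w (Sum.inl none)} := by
    simp only [Set.ofPred_forall]
    exact SignDetermined.iInter fun i => signDetermined_abs_sub_lt _ _ _
  have hdom := (signDetermined_dominates f p).preimage_comp (Sum.map some id)
  have hpos := signDetermined_lt (0 : MvPolynomial (Option σ) ℝ) (MvPolynomial.X none)
  convert (hpos.inter (hcube.inter hdom).exists_sum.compl).exists_option using 1
  ext a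
  simp only [mem_ofPred_eq, isLocalParetoOptimum_pi_iff, mem_inter_iff, map_zero,
    MvPolynomial.eval_X]
  rfl

theorem exists_mvPolynomial_eval_eq_polyMap (n m q : ℕ) (j : Fin m) :
    ∃ f : MvPolynomial (CoeffIndex n m q ⊕ Fin n) ℝ, ∀ a x,
      MvPolynomial.eval (Sum.elim a x) f = polyMap a x j :=
  ⟨∑ ι : multiIndices n q, MvPolynomial.X (Sum.inl (ι, j)) *
    ∏ i, MvPolynomial.X (Sum.inr i) ^ ι.1 i, fun a x => by simp [polyMap]⟩

end Pareto

end ParetoSemialg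

theorem mainTheorem5_general {σ τ : Type*} [Finite τ] {m : ℕ}
    (f : Fin m → MvPolynomial (σ ⊕ τ) ℝ) (p : τ → ℝ) :
    ParetoSemialg.IsSemialgebraic {a : σ → ℝ | ParetoSemialg.IsLocalParetoOptimum
      (fun x j => MvPolynomial.eval (Sum.elim a x) (f j)) p} :=
  (ParetoSemialg.signDetermined_isLocalParetoOptimum f p).isSemialgebraic

theorem mainTheorem5 (n m q : ℕ) :
    ParetoSemialg.IsSemialgebraic
      {a : ParetoSemialg.CoeffIndex n m q → ℝ |
        ParetoSemialg.IsLocalParetoOptimum (ParetoSemialg.polyMap a) (0 : Fin n → ℝ)} := by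
  choose f hf using ParetoSemialg.exists_mvPolynomial_eval_eq_polyMap n m q
  simpa only [hf] using mainTheorem5_general f 0
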